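/- **Setting.** For $i\ge 2$ let $X_i$ be an alphabet with $i$ letters, $X_i^*$ the set of finite strings over it and $|u|_i$ the length of $u\in X_i^*$. A *machine* over $X_2$ is a partial computable function $T:X_2^*\rightharpoonup X_2^*$ with prefix-free domain, and $H_T(x)=\min\{|y|_2 : T(y)=x\}$ (with $\min\emptyset=\infty$). Fix a universal machine $U$, i.e. a machine such that for every machine $T$ there is a constant $c$ with $H_U(x)\le H_T(x)+c$ for all $x$, and write $H_2=H_U$. A *Gödel numbering* is a computable one-to-one function $g:X_i^*\to X_2^*$. The *complexity measure builder* with computable witness $\hat\rho:\mathbb N\times\mathbb N\to\mathbb Q$ assigns to each Gödel numbering $g$ the measure $\rho_g:X_i^*\to\mathbb Q$, $\rho_g(u)=\hat\rho(H_2(g(u)),|u|_i)$. Formulae of first-order arithmetic (with $0$, successor, $+$, $\cdot$, $=$, the connectives $\neg,\wedge,\vee,\to$, the quantifiers $\forall,\exists$, parentheses, and variables written as a symbol $v$ followed by a binary identifier) are written as strings over $X_i$ by means of a fixed uniquely decodable code of the symbols. A *theory* $\mathcal F$ is a set of sentences of this language that is computably enumerable, consistent and sound (every sentence it proves is true in $\mathbb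 N$) and that proves the axioms of Robinson arithmetic; $\mathcal F\vdash x$ means that the string $x$ represents a sentence provable from $\mathcal F$ in classical first-order logic with equality. Consider the following conditions on a measure $\rho_g$: (i) for every theory $\mathcal F$ there is an integer $N_{\mathcal F}$ such that $\mathcal F\vdash x$ implies $\rho_g(x)<N_{\mathcal F}$; (ii) for every integer $N$, $\displaystyle\lim_{n\to\infty} i^{-n}\cdot\operatorname{card}\{x\in X_i^* : |x|_i=n \text{ and } \rho_g(x)\le N\}=0$. A builder satisfies one of these conditions if $\rho_g$ satisfies it for every Gödel numbering $g$. **Proposition.** Let $f:\mathbb N\to\mathbb Q$ be a computable function and let $\rho$ be the complexity measure builder with witness $\hat\rho(x,y)=x/f(y)$ (with the convention $x/0=0$). Then $\rho$ does not satisfy both (i) and (ii). More precisely, for no Gödel numbering $g$ does the measure $\rho_g$ satisfy both (i) and (ii). -/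

import Mathlib

namespace AcceptableComplexity

/-! ### Self-delimiting machines and program-size complexity -/

/-- A self-delimiting Turing machine over the alphabet `X_i = Fin i`: a partial computable
string function whose domain is prefix-free. -/
structure IsMachine {i : ℕ} (T : List (Fin i) →. List (Fin i)) : Prop where
  partrec : Partrec T
  prefixFree : ∀ x y : List (Fin i), (T x).Dom → (T y).Dom → x <+: y → x = y

/-- Program-size complexity of `x` relative to `T`, with `min ∅ = ∞`. -/
noncomputable def complexityOf {i : ℕ} (T : List (Fin i) →. List (Fin i)) (x : List (Fin i)) : ℕ∞ :=
  ⨅ (y : List (Fin i)) (_ : x ∈ T y), (y.length : ℕ∞)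

/-- A universal machine minimizes the program-size complexity up to an additive constant. -/
structure IsUniversal {i : ℕ} (U : List (Fin i) →. List (Fin i)) : Prop where
  isMachine : IsMachine U
  invariance : ∀ T : List (Fin i) →. List (Fin i), IsMachine T →
    ∃ c : ℕ, ∀ x, complexityOf U x ≤ complexityOf T x + c

/-- Program-size complexity as a natural number; for a universal `U` it is never infinite, see
`complexityOf_ne_top`. -/
noncomputable def H {i : ℕ} (U : List (Fin i) →. List (Fin i)) (x : List (Fin i)) : ℕ :=
  (complexityOf U x).toNat

theorem complexityOf_ne_top {i : ℕ} {U : List (Fin i) →. List (Fin i)} (hU : IsUniversal U)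
    (x : List (Fin i)) : complexityOf U x ≠ ⊤ := by
  let T : List (Fin i) →. List (Fin i) := fun y => bif y.isEmpty then Part.some x else Part.none
  have hdom : ∀ y, (T y).Dom → y = [] := by
    intro y hy
    cases y with
    | nil => rfl
    | cons a l => exact absurd hy (by simp [T])
  have hempty : Computable (fun y : List (Fin i) => y.isEmpty) := by
    have h : Primrec (fun y : List (Fin i) => y.length == 0) :=
      Primrec.beq.comp Primrec.list_length (Primrec.const 0)
    exact (h.of_eq (by intro y; cases y <;> simp)).to_comp
  have hT : IsMachine T :=
    ⟨Partrec.cond hempty (Computable.const x) Partrec.none, fun y z hy hz _ => by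
      rw [hdom y hy, hdom z hz]⟩
  obtain ⟨c, hc⟩ := hU.invariance T hT
  have h0 : complexityOf T x ≤ 0 :=
    (iInf₂_le ([] : List (Fin i)) (by simp [T])).trans (by simp)
  have h1 := (hc x).trans (add_le_add_left h0 _)
  exact ne_top_of_le_ne_top (by simp) h1

/-! ### Gödel numberings and complexity measure builders -/

/-- A Gödel numbering of the strings over `X_i`. -/
structure GodelNumbering (i : ℕ) where
  toFun : List (Fin i) → List (Fin 2)
  computable : Computable toFun
  injective : Function.Injective toFun

/-- A rational-valued function is computable if a numerator (as a difference of two natural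
numbers) and a nonzero denominator can be computed. -/
def RatComputable {α : Type} [Primcodable α] (f : α → ℚ) : Prop :=
  ∃ p q r : α → ℕ, Computable p ∧ Computable q ∧ Computable r ∧
    ∀ a, r a ≠ 0 ∧ f a = ((p a : ℚ) - (q a : ℚ)) / (r a : ℚ)

/-- A complexity measure builder, given by its computable witness. -/
structure Builder where
  witness : ℕ × ℕ → ℚ
  computable : RatComputable witness

/-- The measure `ρ_g(u) = ρ̂(H₂(g(u)), |u|)`. -/
noncomputable def Builder.measure (ρ : Builder) (U : List (Fin 2) →. List (Fin 2)) {i : ℕ}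
    (g : GodelNumbering i) (u : List (Fin i)) : ℚ :=
  ρ.witness (H U (g.toFun u), u.length)

theorem ratComputable_div {f : ℕ → ℚ} (hf : RatComputable f) :
    RatComputable (fun z : ℕ × ℕ => (z.1 : ℚ) / f z.2) := by
  obtain ⟨p, q, r, hp, hq, hr, h⟩ := hf
  have mul : Computable₂ (fun a b : ℕ => a * b) := Primrec.nat_mul.to_comp
  have sub : Computable₂ (fun a b : ℕ => a - b) := Primrec.nat_sub.to_comp
  have add : Computable₂ (fun a b : ℕ => a + b) := Primrec.nat_add.to_comp
  have hp' := hp.comp (Computable.snd (α := ℕ) (β := ℕ))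
  have hq' := hq.comp (Computable.snd (α := ℕ) (β := ℕ))
  have hr' := hr.comp (Computable.snd (α := ℕ) (β := ℕ))
  have hx := Computable.fst (α := ℕ) (β := ℕ)
  have d₁ := sub.comp hp' hq'
  have d₂ := sub.comp hq' hp'
  have s := add.comp d₁ d₂
  have one := Computable.const (α := ℕ × ℕ) (1 : ℕ)
  refine ⟨fun z => z.1 * (r z.2 * (p z.2 - q z.2)), fun z => z.1 * (r z.2 * (q z.2 - p z.2)),
    fun z => (((p z.2 - q z.2) + (q z.2 - p z.2)) * ((p z.2 - q z.2) + (q z.2 - p z.2)))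
      + (1 - ((p z.2 - q z.2) + (q z.2 - p z.2))),
    mul.comp hx (mul.comp hr' d₁), mul.comp hx (mul.comp hr' d₂),
    add.comp (mul.comp s s) (sub.comp one s), ?_⟩
  rintro ⟨x, y⟩
  obtain ⟨hr0, hfy⟩ := h y
  have hr0' : (r y : ℚ) ≠ 0 := by exact_mod_cast hr0
  dsimp only
  rw [hfy]
  rcases lt_trichotomy (p y) (q y) with hlt | heq | hlt
  · obtain ⟨k, hk⟩ := Nat.exists_eq_add_of_lt hlt
    have e1 : p y - q y = 0 := by omega
    have e2 : q y - p y = k + 1 := by omega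
    have e3 : 1 - (0 + (k + 1)) = 0 := by omega
    rw [e1, e2, e3]
    refine ⟨by positivity, ?_⟩
    have : (p y : ℚ) - q y = -((k : ℚ) + 1) := by rw [hk]; push_cast; ring
    have hk0 : (k : ℚ) + 1 ≠ 0 := by positivity
    rw [this]
    push_cast
    field_simp
    ring
  · simp [heq]
  · obtain ⟨k, hk⟩ := Nat.exists_eq_add_of_lt hlt
    have e1 : q y - p y = 0 := by omega
    have e2 : p y - q y = k + 1 := by omega
    have e3 : 1 - (k + 1 + 0) = 0 := by omega
    rw [e1, e2, e3]
    refine ⟨by positivity, ?_⟩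
    have : (p y : ℚ) - q y = (k : ℚ) + 1 := by rw [hk]; push_cast; ring
    have hk0 : (k : ℚ) + 1 ≠ 0 := by positivity
    rw [this]
    push_cast
    field_simp
    ring

/-- The builder with witness `ρ̂(x, y) = x / f(y)` (with the convention `x / 0 = 0`). -/
def divBuilder (f : ℕ → ℚ) (hf : RatComputable f) : Builder where
  witness := fun z => (z.1 : ℚ) / f z.2
  computable := ratComputable_div hf

/-! ### First-order arithmetic: syntax, truth, provability -/

/-- Terms of first-order arithmetic; `var n` is the variable with identifier `n`. -/
inductive Term : Type
  | var : ℕ → Term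
  | zero : Term
  | succ : Term → Term
  | add : Term → Term → Term
  | mul : Term → Term → Term

/-- Formulae of first-order arithmetic. -/
inductive Formula : Type
  | equal : Term → Term → Formula
  | neg : Formula → Formula
  | conj : Formula → Formula → Formula
  | disj : Formula → Formula → Formula
  | imp : Formula → Formula → Formula
  | all : ℕ → Formula → Formula
  | ex : ℕ → Formula → Formula

/-- The variable `x` occurs in the term. -/
def Term.Occurs (x : ℕ) : Term → Prop
  | .var n => n = x
  | .zero => False
  | .succ t => t.Occurs x
  | .add s t => s.Occurs x ∨ t.Occurs x
  | .mul s t => s.Occurs x ∨ t.Occurs x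

/-- Substitution of `s` for the variable `x` in a term. -/
def Term.subst (x : ℕ) (s : Term) : Term → Term
  | .var n => if n = x then s else .var n
  | .zero => .zero
  | .succ t => .succ (Term.subst x s t)
  | .add t₁ t₂ => .add (Term.subst x s t₁) (Term.subst x s t₂)
  | .mul t₁ t₂ => .mul (Term.subst x s t₁) (Term.subst x s t₂)

/-- The variable `x` occurs free in the formula. -/
def Formula.Free (x : ℕ) : Formula → Prop
  | .equal s t => s.Occurs x ∨ t.Occurs x
  | .neg φ => φ.Free x
  | .conj φ ψ => φ.Free x ∨ ψ.Free x
  | .disj φ ψ => φ.Free x ∨ ψ.Free x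
  | .imp φ ψ => φ.Free x ∨ ψ.Free x
  | .all n φ => n ≠ x ∧ φ.Free x
  | .ex n φ => n ≠ x ∧ φ.Free x

/-- A sentence is a formula without free variables. -/
def Formula.IsSentence (φ : Formula) : Prop := ∀ x, ¬ φ.Free x

/-- Substitution of `s` for the free occurrences of `x`. -/
def Formula.subst (x : ℕ) (s : Term) : Formula → Formula
  | .equal t₁ t₂ => .equal (Term.subst x s t₁) (Term.subst x s t₂)
  | .neg φ => .neg (φ.subst x s)
  | .conj φ ψ => .conj (φ.subst x s) (ψ.subst x s)
  | .disj φ ψ => .disj (φ.subst x s) (ψ.subst x s)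
  | .imp φ ψ => .imp (φ.subst x s) (ψ.subst x s)
  | .all n φ => if n = x then .all n φ else .all n (φ.subst x s)
  | .ex n φ => if n = x then .ex n φ else .ex n (φ.subst x s)

/-- The term `s` is free for `x` in the formula: substituting it captures no variable. -/
def Formula.FreeFor (x : ℕ) (s : Term) : Formula → Prop
  | .equal _ _ => True
  | .neg φ => φ.FreeFor x s
  | .conj φ ψ => φ.FreeFor x s ∧ ψ.FreeFor x s
  | .disj φ ψ => φ.FreeFor x s ∧ ψ.FreeFor x s
  | .imp φ ψ => φ.FreeFor x s ∧ ψ.FreeFor x s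
  | .all n φ => ¬ (Formula.all n φ).Free x ∨ (¬ s.Occurs n ∧ φ.FreeFor x s)
  | .ex n φ => ¬ (Formula.ex n φ).Free x ∨ (¬ s.Occurs n ∧ φ.FreeFor x s)

/-- The value of a term in the standard model. -/
def Term.val (e : ℕ → ℕ) : Term → ℕ
  | .var n => e n
  | .zero => 0
  | .succ t => t.val e + 1
  | .add s t => s.val e + t.val e
  | .mul s t => s.val e * t.val e

/-- Satisfaction in the standard model under the assignment `e`. -/
def Formula.Holds : (ℕ → ℕ) → Formula → Prop
  | e, .equal s t => s.val e = t.val e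
  | e, .neg φ => ¬ φ.Holds e
  | e, .conj φ ψ => φ.Holds e ∧ ψ.Holds e
  | e, .disj φ ψ => φ.Holds e ∨ ψ.Holds e
  | e, .imp φ ψ => φ.Holds e → ψ.Holds e
  | e, .all n φ => ∀ k : ℕ, φ.Holds (Function.update e n k)
  | e, .ex n φ => ∃ k : ℕ, φ.Holds (Function.update e n k)

/-- Truth in the standard model. -/
def Formula.IsTrue (φ : Formula) : Prop := ∀ e : ℕ → ℕ, φ.Holds e

/-- Provability from the axioms `A` in the classical first-order predicate calculus with equality
(a Hilbert-style calculus, in Kleene's formulation). -/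
inductive Provable (A : Set Formula) : Formula → Prop
  | ax {φ : Formula} : φ ∈ A → Provable A φ
  | mp {φ ψ : Formula} : Provable A φ → Provable A (φ.imp ψ) → Provable A ψ
  | imp_k (φ ψ : Formula) : Provable A (φ.imp (ψ.imp φ))
  | imp_s (φ ψ χ : Formula) : Provable A ((φ.imp ψ).imp ((φ.imp (ψ.imp χ)).imp (φ.imp χ)))
  | conj_intro (φ ψ : Formula) : Provable A (φ.imp (ψ.imp (φ.conj ψ)))
  | conj_left (φ ψ : Formula) : Provable A ((φ.conj ψ).imp φ)
  | conj_right (φ ψ : Formula) : Provable A ((φ.conj ψ).imp ψ)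
  | disj_left (φ ψ : Formula) : Provable A (φ.imp (φ.disj ψ))
  | disj_right (φ ψ : Formula) : Provable A (ψ.imp (φ.disj ψ))
  | disj_elim (φ ψ χ : Formula) : Provable A ((φ.imp χ).imp ((ψ.imp χ).imp ((φ.disj ψ).imp χ)))
  | neg_intro (φ ψ : Formula) : Provable A ((φ.imp ψ).imp ((φ.imp ψ.neg).imp φ.neg))
  | neg_neg (φ : Formula) : Provable A (φ.neg.neg.imp φ)
  | all_elim (x : ℕ) (t : Term) (φ : Formula) : φ.FreeFor x t → Provable A ((φ.all x).imp (φ.subst x t))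
  | all_intro (x : ℕ) {φ ψ : Formula} : ¬ φ.Free x → Provable A (φ.imp ψ) → Provable A (φ.imp (ψ.all x))
  | ex_intro (x : ℕ) (t : Term) (φ : Formula) : φ.FreeFor x t → Provable A ((φ.subst x t).imp (φ.ex x))
  | ex_elim (x : ℕ) {φ ψ : Formula} : ¬ ψ.Free x → Provable A (φ.imp ψ) → Provable A ((φ.ex x).imp ψ)
  | eq_refl (t : Term) : Provable A (.equal t t)
  | eq_subst (x : ℕ) (s t : Term) (φ : Formula) : φ.FreeFor x s → φ.FreeFor x t →
      Provable A ((Formula.equal s t).imp ((φ.subst x s).imp (φ.subst x t)))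

/-- The axioms of Robinson arithmetic `Q`. -/
inductive RobinsonQ : Formula → Prop
  | succ_ne_zero : RobinsonQ (.all 0 (.neg (.equal (.succ (.var 0)) .zero)))
  | succ_inj : RobinsonQ (.all 0 (.all 1
      (.imp (.equal (.succ (.var 0)) (.succ (.var 1))) (.equal (.var 0) (.var 1)))))
  | zero_or_succ : RobinsonQ (.all 0
      (.disj (.equal (.var 0) .zero) (.ex 1 (.equal (.var 0) (.succ (.var 1))))))
  | add_zero : RobinsonQ (.all 0 (.equal (.add (.var 0) .zero) (.var 0)))
  | add_succ : RobinsonQ (.all 0 (.all 1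
      (.equal (.add (.var 0) (.succ (.var 1))) (.succ (.add (.var 0) (.var 1))))))
  | mul_zero : RobinsonQ (.all 0 (.equal (.mul (.var 0) .zero) .zero))
  | mul_succ : RobinsonQ (.all 0 (.all 1
      (.equal (.mul (.var 0) (.succ (.var 1))) (.add (.mul (.var 0) (.var 1)) (.var 0)))))

/-! ### Writing formulae as strings -/

/-- The symbols with which formulae are written. -/
inductive Symb : Type
  | zero | succ | plus | times | equals | neg | conj | disj | imp | all | ex | lpar | rpar
  | v | digitZero | digitOne

/-- The binary notation of `n`, most significant digit first. -/
def binary (n : ℕ) : List Symb :=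
  if n = 0 then [.digitZero]
  else n.bits.reverse.map (fun b => bif b then .digitOne else .digitZero)

/-- A variable is the symbol `v` followed by its identifier in binary. -/
def writeVar (n : ℕ) : List Symb := .v :: binary n

def Term.write : Term → List Symb
  | .var n => writeVar n
  | .zero => [.zero]
  | .succ t => .succ :: t.write
  | .add s t => [.lpar] ++ s.write ++ [.plus] ++ t.write ++ [.rpar]
  | .mul s t => [.lpar] ++ s.write ++ [.times] ++ t.write ++ [.rpar]

def Formula.write : Formula → List Symb
  | .equal s t => [.lpar] ++ s.write ++ [.equals] ++ t.write ++ [.rpar]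
  | .neg φ => .neg :: φ.write
  | .conj φ ψ => [.lpar] ++ φ.write ++ [.conj] ++ ψ.write ++ [.rpar]
  | .disj φ ψ => [.lpar] ++ φ.write ++ [.disj] ++ ψ.write ++ [.rpar]
  | .imp φ ψ => [.lpar] ++ φ.write ++ [.imp] ++ ψ.write ++ [.rpar]
  | .all n φ => [.all] ++ writeVar n ++ φ.write
  | .ex n φ => [.ex] ++ writeVar n ++ φ.write

/-- A uniquely decodable way to write the symbols in the alphabet `X_i`. -/
structure SymbolCode (i : ℕ) where
  code : Symb → List (Fin i)
  uniquelyDecodable : Function.Injective (fun w : List Symb => w.flatMap code)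

/-- The string over `X_i` that represents a formula. -/
def SymbolCode.string {i : ℕ} (C : SymbolCode i) (φ : Formula) : List (Fin i) :=
  φ.write.flatMap C.code

/-! ### Theories and the conditions on a measure -/

/-- A theory satisfying the hypotheses of Gödel's incompleteness theorem: its set of axioms is
c.e., it is sound and consistent, and it proves the axioms of Robinson arithmetic. -/
structure GodelTheory {i : ℕ} (C : SymbolCode i) where
  axioms : Set Formula
  isSentence : ∀ φ ∈ axioms, φ.IsSentence
  finitelySpecified : REPred (fun x : List (Fin i) => ∃ φ ∈ axioms, C.string φ = x)
  sound : ∀ φ : Formula, φ.IsSentence → Provable axioms φ → φ.IsTrue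
  consistent : ¬ ∃ φ : Formula, Provable axioms φ ∧ Provable axioms φ.neg
  arithmetic : ∀ φ : Formula, RobinsonQ φ → Provable axioms φ

/-- The theorems of a theory, as strings over `X_i`. -/
def GodelTheory.theorems {i : ℕ} {C : SymbolCode i} (F : GodelTheory C) : Set (List (Fin i)) :=
  {x | ∃ φ : Formula, φ.IsSentence ∧ Provable F.axioms φ ∧ C.string φ = x}

/-- The bound condition on a measure `r`: for every theory there is an integer bounding the
measure of all its theorems. -/
def BoundCondition {i : ℕ} (C : SymbolCode i) (r : List (Fin i) → ℚ) : Prop :=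
  ∀ F : GodelTheory C, ∃ N : ℤ, ∀ x ∈ F.theorems, r x < (N : ℚ)

/-- The density condition on a measure `r`: for every integer `N`, the proportion of the strings
of length `n` with measure at most `N` tends to `0`. -/
def DensityCondition {i : ℕ} (r : List (Fin i) → ℚ) : Prop :=
  ∀ N : ℤ, Filter.Tendsto
    (fun n : ℕ => ((i : ℝ) ^ n)⁻¹ *
      ({x : List (Fin i) | x.length = n ∧ r x ≤ (N : ℚ)}.ncard : ℝ))
    Filter.atTop (nhds 0)

/-- The builder satisfies the bound condition: every measure that it builds does. -/
def Builder.SatisfiesBound (ρ : Builder) (U : List (Fin 2) →. List (Fin 2)) {i : ℕ}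
    (C : SymbolCode i) : Prop :=
  ∀ g : GodelNumbering i, BoundCondition C (ρ.measure U g)

/-- The builder satisfies the density condition: every measure that it builds does. -/
def Builder.SatisfiesDensity (ρ : Builder) (U : List (Fin 2) →. List (Fin 2)) (i : ℕ) : Prop :=
  ∀ g : GodelNumbering i, DensityCondition (ρ.measure U g)

end AcceptableComplexity

namespace AcceptableComplexity

/-! Dividing by a function of the length alone cannot separate theorems from typical strings, since
among the theorems of each of infinitely many lengths some have complexity at least a fixed fraction
of the length. Logic already proves `∀ vₖ (vₖ = vₖ)` for every `k`. The `2 ^ m` sentences with `2 ^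
m ≤ k < 2 ^ (m + 1)` are distinct and have `3 * m + 10` symbols each, so by counting programs
(`exists_le_H`) one of them, written as a string `x`, has complexity at least `m`, while its length
is at most linear in `m`. The bound condition for Robinson arithmetic then gives `m ≤ N * f |x|`, up
to replacing `N` by its nonnegative part. Conversely, a prefix-free code bounds the complexity of
every string linearly in its length (`exists_H_le`), so all strings of length `|x|` have complexity
at most a constant times `m`, hence at most a constant times `f |x|`. Their measures are therefore
bounded independently of `m`. For large `m` this contradicts the density condition, which provides a
string of length `|x|` whose measure exceeds that bound. -/

/-! ### Substitution and soundness in the standard model -/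

theorem Term.val_congr {e e' : ℕ → ℕ} : ∀ {t : Term}, (∀ x, t.Occurs x → e x = e' x) →
    t.val e = t.val e'
  | .var n, h => h n rfl
  | .zero, _ => rfl
  | .succ t, h => congrArg (· + 1) (Term.val_congr (t := t) h)
  | .add _ _, h => congrArg₂ (· + ·) (Term.val_congr fun x hx => h x (Or.inl hx))
      (Term.val_congr fun x hx => h x (Or.inr hx))
  | .mul _ _, h => congrArg₂ (· * ·) (Term.val_congr fun x hx => h x (Or.inl hx))
      (Term.val_congr fun x hx => h x (Or.inr hx))

theorem Term.val_subst (x : ℕ) (s : Term) (e : ℕ → ℕ) (t : Term) :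
    (Term.subst x s t).val e = t.val (Function.update e x (s.val e)) := by
  induction t with
  | var n =>
    by_cases h : n = x
    · subst h; simp [Term.subst, Term.val]
    · simp [Term.subst, Term.val, h]
  | zero => rfl
  | succ t ih => simp [Term.subst, Term.val, ih]
  | add t₁ t₂ ih₁ ih₂ => simp [Term.subst, Term.val, ih₁, ih₂]
  | mul t₁ t₂ ih₁ ih₂ => simp [Term.subst, Term.val, ih₁, ih₂]

theorem Formula.holds_congr {φ : Formula} : ∀ {e e' : ℕ → ℕ}, (∀ x, φ.Free x → e x = e' x) →
    (φ.Holds e ↔ φ.Holds e') := by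
  have key : ∀ {n : ℕ} {ψ : Formula} {e e' : ℕ → ℕ} (k : ℕ),
      (∀ x, n ≠ x ∧ ψ.Free x → e x = e' x) →
      ∀ x, ψ.Free x → Function.update e n k x = Function.update e' n k x := by
    intro n ψ e e' k h x hx
    by_cases hn : x = n
    · simp [hn]
    · simp [hn, h x ⟨Ne.symm hn, hx⟩]
  induction φ with
  | equal s t =>
    intro e e' h
    simp only [Formula.Holds]
    rw [Term.val_congr fun x hx => h x (Or.inl hx), Term.val_congr fun x hx => h x (Or.inr hx)]
  | neg φ ih => intro e e' h; exact not_congr (ih h)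
  | conj φ ψ ihφ ihψ =>
    intro e e' h
    exact and_congr (ihφ fun x hx => h x (Or.inl hx)) (ihψ fun x hx => h x (Or.inr hx))
  | disj φ ψ ihφ ihψ =>
    intro e e' h
    exact or_congr (ihφ fun x hx => h x (Or.inl hx)) (ihψ fun x hx => h x (Or.inr hx))
  | imp φ ψ ihφ ihψ =>
    intro e e' h
    exact imp_congr (ihφ fun x hx => h x (Or.inl hx)) (ihψ fun x hx => h x (Or.inr hx))
  | all n φ ih => intro e e' h; exact forall_congr' fun k => ih (key k h)
  | ex n φ ih => intro e e' h; exact exists_congr fun k => ih (key k h)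

theorem Formula.holds_update_of_not_free {φ : Formula} {x : ℕ} (h : ¬ φ.Free x) (e : ℕ → ℕ)
    (k : ℕ) : φ.Holds (Function.update e x k) ↔ φ.Holds e :=
  Formula.holds_congr fun y hy => Function.update_of_ne (by rintro rfl; exact h hy) _ _

theorem Term.subst_of_not_occurs {x : ℕ} (s : Term) : ∀ {t : Term}, ¬ t.Occurs x →
    Term.subst x s t = t
  | .var _, h => if_neg h
  | .zero, _ => rfl
  | .succ t, h => congrArg Term.succ (Term.subst_of_not_occurs s (t := t) h)
  | .add _ _, h => congrArg₂ Term.add (Term.subst_of_not_occurs s fun hx => h (Or.inl hx))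
      (Term.subst_of_not_occurs s fun hx => h (Or.inr hx))
  | .mul _ _, h => congrArg₂ Term.mul (Term.subst_of_not_occurs s fun hx => h (Or.inl hx))
      (Term.subst_of_not_occurs s fun hx => h (Or.inr hx))

theorem Formula.subst_of_not_free {x : ℕ} (s : Term) {φ : Formula} (h : ¬ φ.Free x) :
    φ.subst x s = φ := by
  induction φ with
  | equal t₁ t₂ =>
    exact congrArg₂ Formula.equal (Term.subst_of_not_occurs s fun hx => h (Or.inl hx))
      (Term.subst_of_not_occurs s fun hx => h (Or.inr hx))
  | neg φ ih => exact congrArg Formula.neg (ih h)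
  | conj φ ψ ihφ ihψ =>
    exact congrArg₂ Formula.conj (ihφ fun hx => h (Or.inl hx)) (ihψ fun hx => h (Or.inr hx))
  | disj φ ψ ihφ ihψ =>
    exact congrArg₂ Formula.disj (ihφ fun hx => h (Or.inl hx)) (ihψ fun hx => h (Or.inr hx))
  | imp φ ψ ihφ ihψ =>
    exact congrArg₂ Formula.imp (ihφ fun hx => h (Or.inl hx)) (ihψ fun hx => h (Or.inr hx))
  | all n φ ih =>
    by_cases hn : n = x
    · simp [Formula.subst, hn]
    · simp [Formula.subst, hn, ih fun hx => h ⟨hn, hx⟩]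
  | ex n φ ih =>
    by_cases hn : n = x
    · simp [Formula.subst, hn]
    · simp [Formula.subst, hn, ih fun hx => h ⟨hn, hx⟩]

/-- Under a quantifier on `n`, either `x` is not free and neither side changes, or `n` does not
occur in `s`, so the value of `s` is unaffected by updating `n` and the two updates commute. -/
theorem Formula.holds_subst {x : ℕ} {s : Term} {φ : Formula} : φ.FreeFor x s → ∀ e : ℕ → ℕ,
    ((φ.subst x s).Holds e ↔ φ.Holds (Function.update e x (s.val e))) := by
  have key : ∀ {n : ℕ} (e : ℕ → ℕ) (k : ℕ), n ≠ x → ¬ s.Occurs n →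
      Function.update (Function.update e n k) x (s.val (Function.update e n k)) =
        Function.update (Function.update e x (s.val e)) n k := by
    intro n e k hn hs
    rw [Function.update_comm hn, Term.val_congr (t := s) (e' := e)]
    intro y hy
    exact Function.update_of_ne (by rintro rfl; exact hs hy) _ _
  induction φ with
  | equal t₁ t₂ => intro _ e; simp only [Formula.subst, Formula.Holds, Term.val_subst]
  | neg φ ih => intro h e; exact not_congr (ih h e)
  | conj φ ψ ihφ ihψ => intro h e; exact and_congr (ihφ h.1 e) (ihψ h.2 e)
  | disj φ ψ ihφ ihψ => intro h e; exact or_congr (ihφ h.1 e) (ihψ h.2 e)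
  | imp φ ψ ihφ ihψ => intro h e; exact imp_congr (ihφ h.1 e) (ihψ h.2 e)
  | all n φ ih =>
    intro h e
    by_cases hf : (Formula.all n φ).Free x
    · obtain ⟨hs, hφ⟩ := h.resolve_left (not_not_intro hf)
      rw [Formula.subst, if_neg hf.1]
      exact forall_congr' fun k => by rw [ih hφ, key e k hf.1 hs]
    · rw [Formula.subst_of_not_free s hf, Formula.holds_update_of_not_free hf]
  | ex n φ ih =>
    intro h e
    by_cases hf : (Formula.ex n φ).Free x
    · obtain ⟨hs, hφ⟩ := h.resolve_left (not_not_intro hf)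
      rw [Formula.subst, if_neg hf.1]
      exact exists_congr fun k => by rw [ih hφ, key e k hf.1 hs]
    · rw [Formula.subst_of_not_free s hf, Formula.holds_update_of_not_free hf]

/-- Soundness of the calculus for the standard model. -/
theorem Provable.isTrue {A : Set Formula} (hA : ∀ φ ∈ A, φ.IsTrue) {φ : Formula}
    (h : Provable A φ) : φ.IsTrue := by
  induction h with
  | ax h => exact hA _ h
  | mp _ _ ih₁ ih₂ => exact fun e => ih₂ e (ih₁ e)
  | all_elim x t φ h =>
    intro e hφ
    exact (Formula.holds_subst h e).2 (hφ _)
  | all_intro x hx _ ih =>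
    exact fun e hφ k => ih _ ((Formula.holds_update_of_not_free hx e k).2 hφ)
  | ex_intro x t φ h =>
    intro e hφ
    exact ⟨_, (Formula.holds_subst h e).1 hφ⟩
  | ex_elim x hx _ ih =>
    rintro e ⟨k, hk⟩
    exact (Formula.holds_update_of_not_free hx e k).1 (ih _ hk)
  | eq_refl t => exact fun e => rfl
  | eq_subst x s t φ hs ht =>
    intro e (heq : s.val e = t.val e) hφ
    rw [Formula.holds_subst ht, ← heq]
    exact (Formula.holds_subst hs e).1 hφ
  | _ => intro e; simp only [Formula.Holds]; tauto

/-! ### Robinson arithmetic as a theory -/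

theorem RobinsonQ.isTrue {φ : Formula} (h : RobinsonQ φ) : φ.IsTrue := by
  intro e
  cases h <;> simp [Formula.Holds, Term.val]
  case zero_or_succ =>
    rintro (_ | k) <;> simp
  case add_succ => intros; omega
  case mul_succ => intros; ring

theorem RobinsonQ.isSentence {φ : Formula} (h : RobinsonQ φ) : φ.IsSentence := by
  intro x
  cases h <;> simp [Formula.Free, Term.Occurs] <;> omega

theorem RobinsonQ.finite : {φ | RobinsonQ φ}.Finite := by
  refine Set.Finite.subset (Set.toFinite
    {.all 0 (.neg (.equal (.succ (.var 0)) .zero)),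
      .all 0 (.all 1
        (.imp (.equal (.succ (.var 0)) (.succ (.var 1))) (.equal (.var 0) (.var 1)))),
      .all 0 (.disj (.equal (.var 0) .zero) (.ex 1 (.equal (.var 0) (.succ (.var 1))))),
      .all 0 (.equal (.add (.var 0) .zero) (.var 0)),
      .all 0 (.all 1
        (.equal (.add (.var 0) (.succ (.var 1))) (.succ (.add (.var 0) (.var 1))))),
      .all 0 (.equal (.mul (.var 0) .zero) .zero),
      .all 0 (.all 1
        (.equal (.mul (.var 0) (.succ (.var 1))) (.add (.mul (.var 0) (.var 1)) (.var 0))))}) ?_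
  rintro φ h
  cases h <;> simp

theorem rePred_mem_of_finite {α : Type} [Primcodable α] {s : Set α} (hs : s.Finite) :
    REPred (fun x => x ∈ s) := by
  classical
  suffices h : PrimrecPred (fun x => x ∈ s) from
    ComputablePred.to_re ⟨inferInstance, h.decide.to_comp⟩
  induction s, hs using Set.Finite.induction_on with
  | empty => exact ⟨inferInstance, (Primrec.const false).of_eq fun _ => by simp⟩
  | insert _ _ ih => exact (Primrec.eq.comp Primrec.id (Primrec.const _)).or ih

/-- Robinson arithmetic. -/
def robinsonTheory {i : ℕ} (C : SymbolCode i) : GodelTheory C where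
  axioms := {φ | RobinsonQ φ}
  isSentence _ h := h.isSentence
  finitelySpecified := (rePred_mem_of_finite (RobinsonQ.finite.image C.string)).of_eq fun _ =>
    Iff.rfl
  sound _ _ h := h.isTrue fun _ h => h.isTrue
  consistent := by
    rintro ⟨φ, h, hn⟩
    exact hn.isTrue (fun _ h => h.isTrue) 0 (h.isTrue (fun _ h => h.isTrue) 0)
  arithmetic _ h := .ax h

/-! ### Many short theorems of pure logic -/

/-- The sentence `∀ vₖ (vₖ = vₖ)`. -/
def reflSentence (k : ℕ) : Formula := .all k (.equal (.var k) (.var k))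

theorem reflSentence_isSentence (k : ℕ) : (reflSentence k).IsSentence := by
  intro x
  simp only [reflSentence, Formula.Free, Term.Occurs]
  tauto

theorem provable_reflSentence (A : Set Formula) (k : ℕ) : Provable A (reflSentence k) := by
  -- Kleene's rule generalizes only the conclusion of an implication, so `vₖ = vₖ` is first weakened
  -- by a provable closed premise, which is detached afterwards.
  let ψ : Formula := .all 0 (.equal .zero .zero)
  have hfree : ¬ (ψ.imp (ψ.imp ψ)).Free k := by
    simp [ψ, Formula.Free, Term.Occurs]
  exact .mp (.imp_k ψ ψ) (.all_intro k hfree (.mp (.eq_refl (.var k)) (.imp_k _ _)))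

theorem length_binary {m k : ℕ} (h₁ : 2 ^ m ≤ k) (h₂ : k < 2 ^ (m + 1)) :
    (binary k).length = m + 1 := by
  have hk : k ≠ 0 := by have := Nat.two_pow_pos m; omega
  have := Nat.size_le.2 h₂
  have := Nat.lt_size.2 h₁
  simp only [binary, if_neg hk, List.length_map, List.length_reverse, Nat.size_eq_bits_len]
  omega

theorem binary_injOn : Set.InjOn binary {k | k ≠ 0} := by
  intro k hk l hl h
  simp only [binary, if_neg hk, if_neg hl] at h
  have hinj : Function.Injective
      (fun b : Bool => bif b then Symb.digitOne else Symb.digitZero) := by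
    intro a b; cases a <;> cases b <;> simp
  have hbits := List.reverse_injective (List.map_injective_iff.2 hinj h)
  exact Nat.eq_of_testBit_eq fun j => by rw [Nat.testBit_eq_inth, Nat.testBit_eq_inth, hbits]

theorem length_flatMap_le {α β : Type*} {c : α → List β} {M : ℕ} (hc : ∀ a, (c a).length ≤ M)
    (w : List α) : (w.flatMap c).length ≤ M * w.length := by
  induction w with
  | nil => simp
  | cons a w ih =>
    have := hc a
    simp only [List.flatMap_cons, List.length_append, List.length_cons]
    linarith

/-- Unique decodability forbids empty code words. This makes the length of the theorem strings tend
to infinity with `m`. -/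
theorem SymbolCode.length_le {i : ℕ} (C : SymbolCode i) (w : List Symb) :
    w.length ≤ (w.flatMap C.code).length := by
  have hne : ∀ a, C.code a ≠ [] := by
    intro a ha
    have := @C.uniquelyDecodable [a] [] (by simpa using ha)
    simp at this
  induction w with
  | nil => simp
  | cons a w ih =>
    have := List.length_pos_iff.2 (hne a)
    simp only [List.flatMap_cons, List.length_append, List.length_cons]
    omega

theorem SymbolCode.exists_length_bound {i : ℕ} (C : SymbolCode i) :
    ∃ M : ℕ, ∀ a, (C.code a).length ≤ M := by
  let w : List Symb := [.zero, .succ, .plus, .times, .equals, .neg, .conj, .disj, .imp, .all, .ex,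
    .lpar, .rpar, .v, .digitZero, .digitOne]
  have hw : ∀ a, a ∈ w := by intro a; cases a <;> simp [w]
  refine ⟨(w.flatMap C.code).length, fun a => ?_⟩
  obtain ⟨u, v, huv⟩ := List.append_of_mem (hw a)
  simp only [huv, List.flatMap_append, List.flatMap_cons, List.length_append]
  omega

theorem reflSentence_write_length {m k : ℕ} (h₁ : 2 ^ m ≤ k) (h₂ : k < 2 ^ (m + 1)) :
    (reflSentence k).write.length = 3 * m + 10 := by
  simp [reflSentence, Formula.write, Term.write, writeVar, length_binary h₁ h₂]
  omega

/-- Identifiers in this range have equally many binary digits, so equal sentences can be split at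
the same place and the first identifiers compared. -/
theorem reflSentence_string_injOn {i : ℕ} (C : SymbolCode i) (m : ℕ) :
    Set.InjOn (fun k => C.string (reflSentence k)) (Set.Ico (2 ^ m) (2 ^ (m + 1))) := by
  intro k hk l hl h
  have hw := C.uniquelyDecodable h
  simp only [reflSentence, Formula.write, writeVar, List.cons_append, List.nil_append,
    List.append_assoc, List.cons.injEq, true_and] at hw
  have hb := (List.append_inj hw (by
    rw [length_binary hk.1 hk.2, length_binary hl.1 hl.2])).1
  have := Nat.two_pow_pos m
  exact binary_injOn (by have := hk.1; simp; omega) (by have := hl.1; simp; omega) hb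

/-! ### Lower and upper bounds on complexity -/

/-- Among `2 ^ m` strings one has complexity at least `m`. -/
theorem exists_le_H {U : List (Fin 2) →. List (Fin 2)} (hU : IsUniversal U) {m : ℕ}
    {s : Finset ℕ} (hs : 2 ^ m ≤ s.card) {F : ℕ → List (Fin 2)} (hF : Set.InjOn F s) :
    ∃ k ∈ s, m ≤ H U (F k) := by
  by_contra! hlt
  have hprog : ∀ k : s, ∃ y, F k ∈ U y ∧ y.length < m := by
    intro k
    have h : complexityOf U (F k) < m := by
      rw [← ENat.natCast_toNat (complexityOf_ne_top hU (F k))]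
      exact Nat.cast_lt.2 (hlt k k.2)
    obtain ⟨y, hy⟩ := iInf_lt_iff.1 h
    obtain ⟨hUy, hy⟩ := iInf_lt_iff.1 hy
    exact ⟨y, hUy, Nat.cast_lt.1 hy⟩
  choose y hUy hy using hprog
  -- A program determines its output, so this map is injective; but there are only `2 ^ m - 1`
  -- binary strings shorter than `m`.
  let G : s → Σ n : Fin m, List.Vector (Fin 2) n := fun k => ⟨⟨_, hy k⟩, ⟨y k, rfl⟩⟩
  have hG : Function.Injective G := by
    intro k l h
    have hkl : y k = y l := congrArg (fun p => p.2.1) h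
    exact Subtype.ext (hF k.2 l.2 (Part.mem_unique (hUy k) (hkl ▸ hUy l)))
  have hcard := Fintype.card_le_of_injective G hG
  simp only [Fintype.card_coe, Fintype.card_sigma, card_vector, Fintype.card_fin] at hcard
  rw [Fin.sum_univ_eq_sum_range (fun n => 2 ^ n)] at hcard
  have := Nat.geomSum_lt (m := 2) le_rfl (s := Finset.range m) (n := m) (by simp)
  omega

/-- A prefix-free code of the strings over `X_i`. -/
def prefixCode {i : ℕ} (x : List (Fin i)) : List (Fin 2) :=
  -- Each letter is a marker `1` followed by a one-hot block of `i` bits; a `0` in marker position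
  -- ends the string.
  x.flatMap (fun a => 1 :: List.ofFn (fun b : Fin i => if b = a then 1 else 0)) ++ [0]

theorem length_prefixCode {i : ℕ} (x : List (Fin i)) :
    (prefixCode x).length = (i + 1) * x.length + 1 := by
  simp [prefixCode, List.length_flatMap, mul_comm]

theorem prefixCode_prefix {i : ℕ} : ∀ {x y : List (Fin i)}, prefixCode x <+: prefixCode y → x = y
  | [], [], _ => rfl
  | [], b :: y, h => by simp [prefixCode] at h
  | a :: x, [], h => by simp [prefixCode] at h
  | a :: x, b :: y, h => by
    obtain ⟨t, ht⟩ := h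
    simp only [prefixCode, List.flatMap_cons, List.append_assoc, List.cons_append,
      List.cons.injEq, true_and] at ht
    obtain ⟨h₁, h₂⟩ := List.append_inj ht (by simp)
    have hab : a = b := by
      have := congrFun (List.ofFn_injective h₁) a
      simpa using this
    rw [hab, prefixCode_prefix (x := x) (y := y) ⟨t, by simpa [prefixCode] using h₂⟩]

theorem primrec_prefixCode (i : ℕ) : Primrec (prefixCode (i := i)) :=
  Primrec.list_append.comp
    (Primrec.list_flatMap Primrec.id ((Primrec.dom_finite
      (fun a : Fin i => (1 : Fin 2) :: List.ofFn fun b : Fin i => if b = a then 1 else 0)).comp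
        Primrec.snd))
    (Primrec.const [0])

/-- The machine that decodes its input and applies `g`. -/
def decodingMachine {i : ℕ} (g : List (Fin i) → List (Fin 2)) (y : List (Fin 2)) :
    Part (List (Fin 2)) :=
  Nat.rfindOpt fun n => (Encodable.decode (α := List (Fin i)) n).bind fun x =>
    if prefixCode x = y then some (g x) else none

/-- The unbounded search can only stop at a preimage of `y` under the code, and that preimage is
unique. -/
theorem mem_decodingMachine {i : ℕ} {g : List (Fin i) → List (Fin 2)} {y z : List (Fin 2)} :
    z ∈ decodingMachine g y ↔ ∃ x, prefixCode x = y ∧ g x = z := by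
  have hspec : ∀ {z}, z ∈ decodingMachine g y → ∃ x, prefixCode x = y ∧ g x = z := by
    intro z hz
    obtain ⟨n, hn⟩ := Nat.rfindOpt_spec hz
    simp only [Option.mem_def, Option.bind_eq_some_iff, Option.ite_none_right_eq_some,
      Option.some.injEq] at hn
    obtain ⟨x, -, hx⟩ := hn
    exact ⟨x, hx⟩
  refine ⟨hspec, ?_⟩
  rintro ⟨x, rfl, rfl⟩
  have hdom : (decodingMachine g (prefixCode x)).Dom :=
    Nat.rfindOpt_dom.2 ⟨Encodable.encode x, g x, by simp⟩
  obtain ⟨x', hx', hg⟩ := hspec (Part.get_mem hdom)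
  obtain rfl := prefixCode_prefix (hx'.symm ▸ List.prefix_rfl : prefixCode x' <+: prefixCode x)
  exact hg ▸ Part.get_mem hdom

theorem isMachine_decodingMachine {i : ℕ} {g : List (Fin i) → List (Fin 2)} (hg : Computable g) :
    IsMachine (decodingMachine g) where
  partrec := by
    refine Partrec.rfindOpt ?_
    refine Computable.option_bind (Computable.decode.comp Computable.snd) ?_
    have hc : Primrec fun p : (List (Fin 2) × ℕ) × List (Fin i) =>
        decide (prefixCode p.2 = p.1.1) :=
      (Primrec.eq.comp ((primrec_prefixCode i).comp Primrec.snd)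
        (Primrec.fst.comp Primrec.fst)).decide
    refine (Computable.cond hc.to_comp (Computable.option_some.comp (hg.comp Computable.snd))
      (Computable.const none)).of_eq ?_
    intro p
    by_cases h : prefixCode p.2 = p.1.1 <;> simp [h]
  prefixFree := by
    intro y z hy hz h
    obtain ⟨x, rfl, -⟩ := mem_decodingMachine.1 (Part.get_mem hy)
    obtain ⟨x', rfl, -⟩ := mem_decodingMachine.1 (Part.get_mem hz)
    rw [prefixCode_prefix h]

theorem H_le_of_complexityOf_le {U T : List (Fin 2) →. List (Fin 2)} (hU : IsUniversal U) {c : ℕ}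
    {x y : List (Fin 2)} (hc : complexityOf U x ≤ complexityOf T x + c) (hy : x ∈ T y) :
    H U x ≤ y.length + c := by
  have hle : complexityOf T x ≤ y.length := iInf₂_le y hy
  have h : complexityOf U x ≤ ((y.length + c : ℕ) : ℕ∞) := by
    rw [Nat.cast_add]
    exact hc.trans (by gcongr)
  rwa [← ENat.natCast_toNat (complexityOf_ne_top hU x), Nat.cast_le] at h

/-- The prefix code of `x` is a program for `g x` on the decoding machine; universality costs an
additive constant. -/
theorem exists_H_le {U : List (Fin 2) →. List (Fin 2)} (hU : IsUniversal U) {i : ℕ}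
    (g : GodelNumbering i) : ∃ b : ℕ, ∀ x, H U (g.toFun x) ≤ (i + 1) * x.length + b := by
  obtain ⟨c, hc⟩ := hU.invariance (decodingMachine g.toFun)
    (isMachine_decodingMachine g.computable)
  refine ⟨1 + c, fun x => ?_⟩
  have h := H_le_of_complexityOf_le hU (hc _) (mem_decodingMachine.2 ⟨x, rfl, rfl⟩)
  rw [length_prefixCode] at h
  linarith

/-- Without this, both conditions on the builder could hold vacuously. The witness writes the code
of a string in unary. -/
theorem exists_godelNumbering (i : ℕ) : Nonempty (GodelNumbering i) := by
  refine ⟨fun x => List.replicate (Encodable.encode x) 0, ?_, fun x y h => ?_⟩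
  · have h : Primrec fun x : List (Fin i) =>
        (List.range (Encodable.encode x)).map fun _ => (0 : Fin 2) :=
      Primrec.list_map (Primrec.list_range.comp Primrec.encode) (Primrec.const 0)
    exact (h.of_eq fun x => by simp).to_comp
  · exact Encodable.encode_injective (by simpa using congrArg List.length h)

/-! ### Density against the bound on theorems -/

/-- If no string of length `n` exceeded `N`, the proportion would be exactly `1`. Only eventual
proportion below `1` is used from the limit. -/
theorem DensityCondition.eventually_exists {i : ℕ} (hi : 2 ≤ i) {r : List (Fin i) → ℚ}
    (h : DensityCondition r) (N : ℤ) :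
    ∀ᶠ n in Filter.atTop, ∃ x : List (Fin i), x.length = n ∧ (N : ℚ) < r x := by
  filter_upwards [(h N).eventually_lt_const one_pos] with n hn
  by_contra! hall
  have heq : {x : List (Fin i) | x.length = n ∧ r x ≤ (N : ℚ)} = {x | x.length = n} := by
    ext x
    exact ⟨fun h => h.1, fun h => ⟨h, hall x h⟩⟩
  have hcard : {x : List (Fin i) | x.length = n}.ncard = i ^ n := by
    rw [← Nat.card_coe_set_eq]
    exact (Nat.card_eq_fintype_card (α := List.Vector (Fin i) n)).trans (by simp)
  have : (i : ℝ) ≠ 0 := by positivity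
  rw [heq, hcard] at hn
  simp [this] at hn

theorem not_bound_and_density {i : ℕ} (hi : 2 ≤ i) (C : SymbolCode i)
    {U : List (Fin 2) →. List (Fin 2)} (hU : IsUniversal U) {f : ℕ → ℚ} (hf : RatComputable f)
    (g : GodelNumbering i) :
    ¬ (BoundCondition C ((divBuilder f hf).measure U g) ∧
      DensityCondition ((divBuilder f hf).measure U g)) := by
  rintro ⟨hb, hd⟩
  obtain ⟨N, hN⟩ := hb (robinsonTheory C)
  obtain ⟨M, hM⟩ := C.exists_length_bound
  obtain ⟨b, hH⟩ := exists_H_le hU g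
  -- The factor `3 * (i + 1) * M + 1` is the slope in `m` of the complexity bound for strings of
  -- length at most `M * (3 * m + 10)`, plus one to absorb the constant terms. Truncating `N` keeps
  -- the threshold nonnegative.
  obtain ⟨n₀, hn₀⟩ := Filter.eventually_atTop.1
    (hd.eventually_exists hi (N.toNat * (3 * (i + 1) * M + 1) : ℕ))
  -- The second inequality lets one further `m` dominate the constant terms of that bound.
  obtain ⟨m, hm₁, hm₂⟩ : ∃ m, n₀ ≤ m ∧ 10 * (i + 1) * M + b ≤ m :=
    ⟨max n₀ (10 * (i + 1) * M + b), le_max_left .., le_max_right ..⟩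
  obtain ⟨k, hk, hmk⟩ := exists_le_H hU (m := m) (s := Finset.Ico (2 ^ m) (2 ^ (m + 1)))
    (by rw [Nat.card_Ico, pow_succ]; omega)
    (F := fun k => g.toFun (C.string (reflSentence k)))
    (by
      rw [Finset.coe_Ico]
      exact g.injective.comp_injOn (reflSentence_string_injOn C m))
  rw [Finset.mem_Ico] at hk
  have hlen := reflSentence_write_length hk.1 hk.2
  set x := C.string (reflSentence k) with hx
  have hx₁ : n₀ ≤ x.length := by
    have := C.length_le (reflSentence k).write
    rw [hlen] at this
    exact le_trans (by omega) this
  have hx₂ : x.length ≤ M * (3 * m + 10) := hlen ▸ length_flatMap_le hM _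
  have hxN := hN x ⟨_, reflSentence_isSentence k, provable_reflSentence _ k, rfl⟩
  obtain ⟨y, hy, hyN⟩ := hn₀ _ hx₁
  have hHy := hH y
  simp only [Builder.measure, divBuilder, hy, Int.cast_natCast] at hxN hyN
  rw [hy] at hHy
  -- The measure of `y` exceeds a nonnegative threshold, whereas a negative or zero denominator
  -- (with `x / 0 = 0`) would make it at most `0`.
  have hfpos : 0 < f x.length := by
    by_contra! hneg
    exact absurd (hyN.trans_le (div_nonpos_of_nonneg_of_nonpos (by positivity) hneg))
      (not_lt.2 (by positivity))
  rw [lt_div_iff₀ hfpos] at hyN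
  rw [div_lt_iff₀ hfpos] at hxN
  have hNle : (N : ℚ) ≤ (N.toNat : ℚ) := by exact_mod_cast Int.self_le_toNat N
  have h₁ : (m : ℚ) ≤ N.toNat * f x.length :=
    (Nat.cast_le.2 hmk).trans (hxN.le.trans (mul_le_mul_of_nonneg_right hNle hfpos.le))
  have h₂ : (H U (g.toFun y) : ℚ) ≤ (i + 1) * (M * (3 * m + 10)) + b := by
    exact_mod_cast hHy.trans (by gcongr)
  have h₃ : (10 * (i + 1) * M + b : ℚ) ≤ m := by exact_mod_cast hm₂
  have h₄ := mul_le_mul_of_nonneg_left h₁ (by positivity : (0 : ℚ) ≤ 3 * (i + 1) * M + 1)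
  push_cast at hyN
  linarith

end AcceptableComplexity

theorem mainTheorem6 (i : ℕ) (hi : 2 ≤ i) (C : AcceptableComplexity.SymbolCode i)
    (U : List (Fin 2) →. List (Fin 2)) (hU : AcceptableComplexity.IsUniversal U)
    (f : ℕ → ℚ) (hf : AcceptableComplexity.RatComputable f) :
    ¬ ((AcceptableComplexity.divBuilder f hf).SatisfiesBound U C ∧
        (AcceptableComplexity.divBuilder f hf).SatisfiesDensity U i) ∧
    ∀ g : AcceptableComplexity.GodelNumbering i,
      ¬ (AcceptableComplexity.BoundCondition C
            ((AcceptableComplexity.divBuilder f hf).measure U g) ∧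
          AcceptableComplexity.DensityCondition
            ((AcceptableComplexity.divBuilder f hf).measure U g)) := by
  refine ⟨?_, AcceptableComplexity.not_bound_and_density hi C hU hf⟩
  rintro ⟨hb, hd⟩
  obtain ⟨g⟩ := AcceptableComplexity.exists_godelNumbering i
  exact AcceptableComplexity.not_bound_and_density hi C hU hf g ⟨hb g, hd g⟩
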